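/- **Definitions.** All algebras are of type $(2,2,1,1,0,0)$, with operations $\wedge,\vee,{}',{}^{\sim},0,1$. A *BZ-lattice* is an algebra $\mathbf L=(L,\wedge,\vee,{}',{}^{\sim},0,1)$ such that $(L,\wedge,\vee,0,1)$ is a bounded lattice and, for all $a,b\in L$: $a''=a$; $a\le b$ implies $b'\le a'$; $a\wedge a'\le b\vee b'$; $a\wedge a^{\sim}=0$; $a\le a^{\sim\sim}$; $a\le b$ implies $b^{\sim}\le a^{\sim}$; $a^{\sim\prime}=a^{\sim\sim}$. Write $\Diamond a=a^{\sim\sim}$ and $\Box a=a'^{\sim}$. A *PBZ$^*$-lattice* is a BZ-lattice that satisfies $(a\wedge a')^{\sim}\le a^{\sim}\vee\Box a$ for all $a$ and is paraorthomodular: $a\le b$ and $a'\wedge b=0$ imply $a=b$. Let $\mathbb{SDM}$ be the variety of all PBZ$^*$-lattices satisfying $(x\wedge y)^{\sim}\approx x^{\sim}\vee y^{\sim}$, and let $\mathbb{SK}$ be the subvariety of $\mathbb{SDM}$ axiomatised relative to $\mathbb{SDM}$ by $x\wedge\Diamond y\le\Box x\vee y$. For $\mathbf A\in\mathbb{SDM}$,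 let $\{0\}^{\varepsilon}$ be the join, in the congruence lattice of $\mathbf A$, of all congruences $\theta$ with $0/\theta=\{0\}$; $\mathbf A$ is *reduced* if $\{0\}^{\varepsilon}$ is the identity relation. Let $\mathbb{SDM}_{\varepsilon}$ be the class of all reduced algebras in $\mathbb{SDM}$. Formulas are terms over countably infinitely many variables. For a class $\mathbb K$ of algebras, a set $\Theta$ of equations and an equation $e$, $\Theta\vDash_{\mathbb K}e$ means that, for every $\mathbf A\in\mathbb K$, every assignment in $\mathbf A$ that satisfies all equations in $\Theta$ satisfies $e$. The *$0$-assertional logic* of $\mathbb{SDM}$ is the relation given by $\Gamma\vdash\varphi$ iff $\{\gamma\approx0:\gamma\in\Gamma\}\vDash_{\mathbb{SDM}}\varphi\approx0$. A *deductive system* is a finitary, substitution-invariant consequence relation $\vdash$ between sets of formulas and formulas. A class $\mathbb K$ is an *equivalent algebraic semantics* of $\vdash$ if there are a finite set $\tau(x)$ of equations in one variable and a finite set $\Delta(x,y)$ of formulas in two variables such that, for all sets $\Gamma\cup\{\varphi\}$ of formulas and all sets $\Theta\cup\{s\approx t\}$ of equations: 1. $\Gamma\vdash\varphi$ iff $\tau[\Gamma]\vDash_{\mathbb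 K}\tau(\varphi)$; 2. $\Theta\vDash_{\mathbb K}s\approx t$ iff $\Delta[\Theta]\vdash\Delta(s,t)$; 3. $\varphi$ and $\Delta[\tau(\varphi)]$ are interderivable in $\vdash$; 4. $s\approx t$ and $\tau[\Delta(s,t)]$ are interderivable in $\vDash_{\mathbb K}$. An *equivalent variety semantics* is an equivalent algebraic semantics that is a variety (a class axiomatised by identities). A deductive system is *strongly algebraisable* if it has an equivalent variety semantics. **Theorem.** The $0$-assertional logic of $\mathbb{SDM}$ is a strongly algebraisable deductive system. Its unique equivalent variety semantics is $\mathbb{SDM}_{\varepsilon}$, and $$\mathbb{SDM}_{\varepsilon}=\mathbb{SK}.$$ -/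

import Mathlib

open FirstOrder CategoryTheory

universe u

/-! Universal algebra and abstract algebraic logic. Algebras of a given similarity type are
structures for a first-order language of which only the function symbols matter. -/

namespace UAlg

section General

variable (L : FirstOrder.Language.{0, 0})

/-- Formulas of the logic: terms over countably many variables. -/
abbrev Fm : Type := L.Term ℕ

/-- Equations `s ≈ t` between formulas. -/
abbrev Eqn : Type := L.Term ℕ × L.Term ℕ

/-- Classes of algebras of the similarity type `L`. -/
abbrev AlgClass : Type (u + 1) := Set (Bundled.{u} L.Structure)

variable {L}

/-- The equation `e` holds in `A` under the assignment `v`. -/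
def Eqn.HoldsAt {A : Type u} [L.Structure A] (e : Eqn L) (v : ℕ → A) : Prop :=
  e.1.realize v = e.2.realize v

/-- The class of all algebras satisfying all the identities in `E`. -/
def equationalClass (E : Set (Eqn L)) : AlgClass.{u} L :=
  {A | ∀ e ∈ E, ∀ v : ℕ → A, e.HoldsAt v}

/-- A variety is a class of algebras axiomatised by identities. -/
def IsVariety (K : AlgClass.{u} L) : Prop :=
  ∃ E : Set (Eqn L), K = equationalClass E

/-- Equational consequence relative to the class `K`: `Θ ⊨_K e`. -/
def EqConseq (K : AlgClass.{u} L) (Θ : Set (Eqn L)) (e : Eqn L) : Prop :=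
  ∀ A ∈ K, ∀ v : ℕ → A, (∀ d ∈ Θ, d.HoldsAt v) → e.HoldsAt v

/-- A relation between sets of formulas and formulas. -/
abbrev Consequence (L : FirstOrder.Language.{0, 0}) : Type := Set (Fm L) → Fm L → Prop

/-- Deductive systems: substitution-invariant finitary consequence relations. -/
structure IsDeductiveSystem (R : Consequence L) : Prop where
  refl : ∀ (Γ : Set (Fm L)) (φ : Fm L), φ ∈ Γ → R Γ φ
  cut : ∀ (Γ Γ' : Set (Fm L)) (φ : Fm L), (∀ ψ ∈ Γ', R Γ ψ) → R Γ' φ → R Γ φ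
  structural : ∀ (Γ : Set (Fm L)) (φ : Fm L) (σ : ℕ → Fm L),
    R Γ φ → R ((fun ψ => ψ.subst σ) '' Γ) (φ.subst σ)
  finitary : ∀ (Γ : Set (Fm L)) (φ : Fm L), R Γ φ →
    ∃ Γ₀ : Set (Fm L), Γ₀ ⊆ Γ ∧ Γ₀.Finite ∧ R Γ₀ φ

/-- The `c`-assertional logic of `K`: `Γ ⊢ φ` iff `{γ ≈ c : γ ∈ Γ} ⊨_K φ ≈ c`. -/
def assertionalLogic (K : AlgClass.{u} L) (c : L.Constants) : Consequence L :=
  fun Γ φ => EqConseq K ((fun γ => (γ, c.term)) '' Γ) (φ, c.term)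

/-- The instances `τ(φ)` of a set `τ` of equations in one variable. -/
def tauOf (τ : Set (L.Term (Fin 1) × L.Term (Fin 1))) (φ : Fm L) : Set (Eqn L) :=
  (fun e => (e.1.subst ![φ], e.2.subst ![φ])) '' τ

/-- The instances `Δ(φ, ψ)` of a set `Δ` of formulas in two variables. -/
def deltaOf (Δ : Set (L.Term (Fin 2))) (e : Eqn L) : Set (Fm L) :=
  (fun d => d.subst ![e.1, e.2]) '' Δ

/-- `K` is an equivalent algebraic semantics of the logic `R`, as witnessed by the defining
equations `τ` and the equivalence formulas `Δ`. -/
structure IsAlgebraisedBy (R : Consequence L) (K : AlgClass.{u} L)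
    (τ : Set (L.Term (Fin 1) × L.Term (Fin 1))) (Δ : Set (L.Term (Fin 2))) : Prop where
  logic_iff : ∀ (Γ : Set (Fm L)) (φ : Fm L),
    R Γ φ ↔ ∀ e ∈ tauOf τ φ, EqConseq K (⋃ γ ∈ Γ, tauOf τ γ) e
  eqn_iff : ∀ (Θ : Set (Eqn L)) (e : Eqn L),
    EqConseq K Θ e ↔ ∀ ψ ∈ deltaOf Δ e, R (⋃ d ∈ Θ, deltaOf Δ d) ψ
  formula_equiv : ∀ φ : Fm L,
    (∀ ψ ∈ ⋃ e ∈ tauOf τ φ, deltaOf Δ e, R {φ} ψ) ∧ R (⋃ e ∈ tauOf τ φ, deltaOf Δ e) φ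
  eqn_equiv : ∀ e : Eqn L,
    (∀ d ∈ ⋃ ψ ∈ deltaOf Δ e, tauOf τ ψ, EqConseq K {e} d) ∧
      EqConseq K (⋃ ψ ∈ deltaOf Δ e, tauOf τ ψ) e

/-- Equivalent algebraic semantics in the sense of Blok and Pigozzi: there are finitely many
defining equations and finitely many equivalence formulas. -/
def IsEquivalentAlgebraicSemantics (R : Consequence L) (K : AlgClass.{u} L) : Prop :=
  ∃ (τ : Set (L.Term (Fin 1) × L.Term (Fin 1))) (Δ : Set (L.Term (Fin 2))),
    τ.Finite ∧ Δ.Finite ∧ IsAlgebraisedBy R K τ Δ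

/-- An equivalent algebraic semantics that is a variety. -/
def IsEquivalentVarietySemantics (R : Consequence L) (K : AlgClass.{u} L) : Prop :=
  IsVariety K ∧ IsEquivalentAlgebraicSemantics R K

/-- A logic is strongly algebraisable if it is a deductive system and has an equivalent algebraic
semantics that is a variety (of algebras in the universe `u`). -/
def IsStronglyAlgebraisable (R : Consequence L) : Prop :=
  IsDeductiveSystem R ∧ ∃ K : AlgClass.{u} L, IsEquivalentVarietySemantics R K

/-- Congruences: equivalence relations compatible with all the operations. -/
def IsCongruence {A : Type u} [L.Structure A] (θ : Setoid A) : Prop :=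
  ∀ (n : ℕ) (f : L.Functions n) (x y : Fin n → A), (∀ i, θ (x i) (y i)) →
    θ (Language.Structure.funMap f x) (Language.Structure.funMap f y)

/-- The class `c/θ` of the constant `c`. -/
def constClass {A : Type u} [L.Structure A] (c : L.Constants) (θ : Setoid A) : Set A :=
  {a | θ a (c : A)}

/-- `I^ε`: the join, in the congruence lattice, of all the congruences `ψ` with `c/ψ = I`, that is,
the least congruence that contains all of them. -/
def epsilon {A : Type u} [L.Structure A] (c : L.Constants) (I : Set A) : Setoid A :=
  sInf {θ : Setoid A | IsCongruence (L := L) θ ∧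
    ∀ ψ : Setoid A, IsCongruence (L := L) ψ → constClass c ψ = I → ψ ≤ θ}

/-- `A` is reduced: `{0}^ε` is the identity relation. -/
def IsReduced (c : L.Constants) (A : Type u) [L.Structure A] : Prop :=
  epsilon c ({(c : A)} : Set A) = ⊥

/-- The class `V_ε` of all the reduced algebras in `V`. -/
def reducedAlgebras (V : AlgClass.{u} L) (c : L.Constants) : AlgClass.{u} L :=
  {A | A ∈ V ∧ IsReduced c A}

end General

end UAlg

/-! PBZ*-lattices. -/

namespace PBZ

/-- The operation symbols of type `(2, 2, 1, 1, 0, 0)`. -/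
inductive Op : ℕ → Type
  | meet : Op 2
  | join : Op 2
  | kleene : Op 1
  | brouwer : Op 1
  | zero : Op 0
  | one : Op 0

/-- The language of BZ-lattices. -/
def lang : FirstOrder.Language.{0, 0} := ⟨Op, fun _ => Empty⟩

/-- The constant symbol `0`. -/
def zeroSymb : lang.Constants := Op.zero

section Operations

variable {A : Type u} [lang.Structure A]

def meet (a b : A) : A := Language.Structure.funMap (L := lang) Op.meet ![a, b]

def join (a b : A) : A := Language.Structure.funMap (L := lang) Op.join ![a, b]

/-- The Kleene complement `a'`. -/
def kl (a : A) : A := Language.Structure.funMap (L := lang) Op.kleene ![a]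

/-- The Brouwer complement `a^∼`. -/
def br (a : A) : A := Language.Structure.funMap (L := lang) Op.brouwer ![a]

variable (A) in
def zero : A := Language.Structure.funMap (L := lang) Op.zero ![]

variable (A) in
def one : A := Language.Structure.funMap (L := lang) Op.one ![]

/-- The lattice order. -/
def le (a b : A) : Prop := meet a b = a

/-- `◇a = a^∼∼`. -/
def dia (a : A) : A := br (br a)

/-- `□a = a'^∼`. -/
def box (a : A) : A := br (kl a)

end Operations

structure IsBoundedLattice (A : Type u) [lang.Structure A] : Prop where
  meet_comm : ∀ a b : A, meet a b = meet b a
  join_comm : ∀ a b : A, join a b = join b a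
  meet_assoc : ∀ a b c : A, meet (meet a b) c = meet a (meet b c)
  join_assoc : ∀ a b c : A, join (join a b) c = join a (join b c)
  meet_join : ∀ a b : A, meet a (join a b) = a
  join_meet : ∀ a b : A, join a (meet a b) = a
  zero_le : ∀ a : A, le (zero A) a
  le_one : ∀ a : A, le a (one A)

structure IsBoundedInvolutionLattice (A : Type u) [lang.Structure A] : Prop
    extends IsBoundedLattice A where
  kl_kl : ∀ a : A, kl (kl a) = a
  kl_anti : ∀ a b : A, le a b → le (kl b) (kl a)

structure IsPseudoKleene (A : Type u) [lang.Structure A] : Prop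
    extends IsBoundedInvolutionLattice A where
  kleene : ∀ a b : A, le (meet a (kl a)) (join b (kl b))

structure IsBZLattice (A : Type u) [lang.Structure A] : Prop extends IsPseudoKleene A where
  meet_br : ∀ a : A, meet a (br a) = zero A
  le_br_br : ∀ a : A, le a (br (br a))
  br_anti : ∀ a b : A, le a b → le (br b) (br a)
  kl_br : ∀ a : A, kl (br a) = br (br a)

structure IsBZStarLattice (A : Type u) [lang.Structure A] : Prop extends IsBZLattice A where
  star : ∀ a : A, le (br (meet a (kl a))) (join (br a) (box a))

def IsParaorthomodular (A : Type u) [lang.Structure A] : Prop :=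
  ∀ a b : A, le a b → meet (kl a) b = zero A → a = b

/-- PBZ*-lattices: paraorthomodular BZ*-lattices. -/
structure IsPBZStarLattice (A : Type u) [lang.Structure A] : Prop
    extends IsBZStarLattice A where
  para : IsParaorthomodular A

/-- The strong De Morgan law `(x ∧ y)^∼ ≈ x^∼ ∨ y^∼`. -/
def StrongDeMorgan (A : Type u) [lang.Structure A] : Prop :=
  ∀ x y : A, br (meet x y) = join (br x) (br y)

/-- The identity `x ∧ ◇y ≤ □x ∨ y`. -/
def IdentitySK (A : Type u) [lang.Structure A] : Prop :=
  ∀ x y : A, le (meet x (dia y)) (join (box x) y)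

/-- The variety of PBZ*-lattices satisfying the strong De Morgan law. -/
def SDM : UAlg.AlgClass.{u} lang :=
  {A | IsPBZStarLattice A ∧ StrongDeMorgan A}

/-- The subvariety of `SDM` axiomatised by `x ∧ ◇y ≤ □x ∨ y`. -/
def SK : UAlg.AlgClass.{u} lang :=
  {A | A ∈ SDM ∧ IdentitySK A}

end PBZ

/-! In an algebra of `SDM` the operations ◇ and □ are lattice homomorphisms onto sharp elements
(those with ◇p = p), and the two complements act on the pair (◇a, □a). So having the same ◇ and the
same □ is a congruence. Its 0-class is {0}, since a ≤ ◇a. It is the greatest congruence with that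
0-class. Let ψ be another one and let p, q be sharp with p ψ q. Then p ∧ (p ∧ q)' ψ p ∧ p' = 0, so p
∧ (p ∧ q)' = 0, and paraorthomodularity gives p = p ∧ q; by symmetry p = q. Apply this to ◇a, ◇b and
to □a, □b. Hence {0}^ε is this congruence, and an algebra is reduced iff ◇ and □ jointly separate
its points, which is what the identity of `SK` says (`identitySK_iff`). Passing to the quotient by
this congruence reflects 0, so `SDM` and `SK` have the same 0-assertional logic. In `SK` an equality
amounts to two equalities of sharp elements, and these amount to four terms vanishing: these terms
are the equivalence formulas. Finitarity comes from ultraproducts, because `SDM` is a variety: given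
strong De Morgan, paraorthomodularity is the orthomodular law for elements ◇x. Uniqueness is the
Blok–Pigozzi argument: two equivalent variety semantics have interderivable equivalence formulas,
hence the same identities. -/

namespace PBZ

/-! ### Arithmetic of ◇ and □, paraorthomodularity, and separation of points -/

section Order

variable {A : Type u} [lang.Structure A]

namespace IsBoundedLattice

variable (h : IsBoundedLattice A)
include h

theorem meet_self (a : A) : meet a a = a := by
  have := h.meet_join a (meet a a)
  rwa [h.join_meet] at this

theorem le_antisymm {a b : A} (h₁ : le a b) (h₂ : le b a) : a = b := by
  rw [← h₁, h.meet_comm, h₂]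

theorem le_trans {a b c : A} (h₁ : le a b) (h₂ : le b c) : le a c := by
  unfold le at *
  rw [← h₁, h.meet_assoc, h₂]

theorem meet_le_right (a b : A) : le (meet a b) b := by
  unfold le
  rw [h.meet_assoc, h.meet_self]

theorem meet_le_left (a b : A) : le (meet a b) a := by
  rw [h.meet_comm]
  exact h.meet_le_right b a

theorem le_meet {a b c : A} (h₁ : le a b) (h₂ : le a c) : le a (meet b c) := by
  unfold le at *
  rw [← h.meet_assoc, h₁, h₂]

theorem le_join_left (a b : A) : le a (join a b) := h.meet_join a b

theorem le_join_right (a b : A) : le b (join a b) := by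
  rw [h.join_comm]
  exact h.meet_join b a

theorem join_eq_right {a b : A} (h₁ : le a b) : join a b = b := by
  have := h.join_meet b a
  rwa [h.meet_comm, h₁, h.join_comm] at this

theorem join_le {a b c : A} (h₁ : le a c) (h₂ : le b c) : le (join a b) c := by
  have h₃ : join (join a b) c = c := by
    rw [h.join_assoc, h.join_eq_right h₂, h.join_eq_right h₁]
  have := h.meet_join (join a b) c
  rwa [h₃] at this

theorem eq_zero_of_le {a : A} (h₁ : le a (zero A)) : a = zero A :=
  h.le_antisymm h₁ (h.zero_le a)

end IsBoundedLattice

namespace IsBZLattice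

variable (h : IsBZLattice A)
include h

theorem br_br_br (a : A) : br (br (br a)) = br a :=
  h.le_antisymm (h.br_anti _ _ (h.le_br_br a)) (h.le_br_br (br a))

theorem dia_br (a : A) : dia (br a) = br a := h.br_br_br a

theorem dia_dia (a : A) : dia (dia a) = dia a := h.br_br_br (br a)

theorem dia_box (a : A) : dia (box a) = box a := h.br_br_br (kl a)

theorem le_dia (a : A) : le a (dia a) := h.le_br_br a

/-- The Brouwer complement is antitone with a ≤ a^∼∼, so it forms a Galois connection with itself
and turns joins into meets; strong De Morgan is needed only for the dual law. -/
theorem br_join (a b : A) : br (join a b) = meet (br a) (br b) := by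
  refine h.le_antisymm (h.le_meet (h.br_anti _ _ (h.le_join_left a b))
    (h.br_anti _ _ (h.le_join_right a b))) ?_
  refine h.le_trans (h.le_br_br _) (h.br_anti _ _ (h.join_le ?_ ?_))
  · exact h.le_trans (h.le_br_br a) (h.br_anti _ _ (h.meet_le_left _ _))
  · exact h.le_trans (h.le_br_br b) (h.br_anti _ _ (h.meet_le_right _ _))

theorem kl_join (a b : A) : kl (join a b) = meet (kl a) (kl b) := by
  refine h.le_antisymm (h.le_meet (h.kl_anti _ _ (h.le_join_left a b))
    (h.kl_anti _ _ (h.le_join_right a b))) ?_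
  have : le (join a b) (kl (meet (kl a) (kl b))) := by
    refine h.join_le ?_ ?_
    · simpa only [h.kl_kl] using h.kl_anti _ _ (h.meet_le_left (kl a) (kl b))
    · simpa only [h.kl_kl] using h.kl_anti _ _ (h.meet_le_right (kl a) (kl b))
  simpa only [h.kl_kl] using h.kl_anti _ _ this

theorem kl_meet (a b : A) : kl (meet a b) = join (kl a) (kl b) := by
  rw [← h.kl_kl (join (kl a) (kl b)), h.kl_join, h.kl_kl, h.kl_kl]

theorem br_le_kl (a : A) : le (br a) (kl a) := by
  have := h.kl_anti _ _ (h.le_br_br a)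
  rwa [← h.kl_br, h.kl_kl] at this

theorem box_le (a : A) : le (box a) a := by
  have := h.br_le_kl (kl a)
  rwa [h.kl_kl] at this

theorem br_zero : br (zero A) = one A :=
  h.le_antisymm (h.le_one _)
    (h.le_trans (h.le_br_br _) (h.br_anti _ _ (h.zero_le _)))

theorem br_one : br (one A) = zero A := by
  rw [← h.meet_br (one A), h.meet_comm]
  exact (h.le_one _).symm

theorem dia_zero : dia (zero A) = zero A := by rw [dia, h.br_zero, h.br_one]

theorem box_zero : box (zero A) = zero A := h.eq_zero_of_le (h.box_le _)

theorem box_meet (a b : A) : box (meet a b) = meet (box a) (box b) := by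
  rw [box, h.kl_meet, h.br_join]; rfl

theorem box_kl (a : A) : box (kl a) = br (dia a) := by
  rw [box, h.kl_kl, dia, h.br_br_br]

/-- The Kleene and the Brouwer complement agree on sharp elements. -/
theorem kl_eq_br {a : A} (ha : dia a = a) : kl a = br a := by
  rw [← ha, dia, h.kl_br]

theorem dia_kl_of_sharp {a : A} (ha : dia a = a) : dia (kl a) = kl a := by
  rw [h.kl_eq_br ha, h.dia_br]

theorem meet_kl_of_sharp {a : A} (ha : dia a = a) : meet (kl a) a = zero A := by
  rw [h.kl_eq_br ha, h.meet_comm, h.meet_br]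

theorem box_of_sharp {a : A} (ha : dia a = a) : box a = a := by
  rw [box, h.kl_eq_br ha]; exact ha

section StrongDeMorgan

variable (hs : StrongDeMorgan A)
include hs

/-- With both De Morgan laws for ^∼ available, applying it twice preserves meets and joins. -/
theorem dia_meet (a b : A) : dia (meet a b) = meet (dia a) (dia b) := by
  rw [dia, hs, h.br_join]; rfl

theorem dia_join (a b : A) : dia (join a b) = join (dia a) (dia b) := by
  rw [dia, h.br_join, hs]; rfl

theorem box_join (a b : A) : box (join a b) = join (box a) (box b) := by
  rw [box, h.kl_join, hs]; rfl

end StrongDeMorgan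

end IsBZLattice

/-- The orthomodular law for the elements of the form `◇a`. -/
def DiamondOrthomodular (A : Type u) [lang.Structure A] : Prop :=
  ∀ x y : A, join (meet (dia x) (dia y)) (meet (kl (meet (dia x) (dia y))) (dia y)) = dia y

/-- With p = ◇x ∧ ◇y, strong De Morgan makes both p and s = p' ∧ ◇y sharp. Paraorthomodularity
applies to p ∨ s ≤ ◇y because (p ∨ s)' ∧ ◇y lies below s' ∧ s = 0. -/
theorem IsBZLattice.diamondOrthomodular_of_paraorthomodular (h : IsBZLattice A)
    (hs : StrongDeMorgan A) (hp : IsParaorthomodular A) : DiamondOrthomodular A := by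
  intro x y
  set p := meet (dia x) (dia y) with hpdef
  have hps : dia p = p := by rw [hpdef, h.dia_meet hs, h.dia_dia, h.dia_dia]
  set s := meet (kl p) (dia y) with hsdef
  have hss : dia s = s := by rw [hsdef, h.dia_meet hs, h.dia_kl_of_sharp hps, h.dia_dia]
  refine hp _ _ (h.join_le (h.meet_le_right _ _) (h.meet_le_right _ _)) (h.eq_zero_of_le ?_)
  rw [← h.meet_kl_of_sharp hss, h.kl_join]
  refine h.le_meet (h.le_trans (h.meet_le_left _ _) (h.meet_le_right _ _))
    (h.le_meet (h.le_trans (h.meet_le_left _ _) (h.meet_le_left _ _)) (h.meet_le_right _ _))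

/-- Applying ^∼ twice to a' ∧ b = 0 gives (□a)^∼ ∧ ◇b = 0. The orthomodular law for □a ≤ ◇b then
forces □a = ◇b, and the chain □a ≤ a ≤ b ≤ ◇b collapses. -/
theorem IsBZLattice.paraorthomodular_of_diamondOrthomodular (h : IsBZLattice A)
    (hs : StrongDeMorgan A) (ho : DiamondOrthomodular A) : IsParaorthomodular A := by
  intro a b hab h0
  have h1 : meet (br (box a)) (dia b) = zero A := by
    have := hs (kl a) b
    rw [h0, h.br_zero] at this
    rw [← h.br_one, this, h.br_join]; rfl
  have h2 : le (box a) (dia b) := h.le_trans (h.box_le a) (h.le_trans hab (h.le_dia b))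
  have h3 := ho (box a) b
  rw [h.dia_box, h2, h.kl_eq_br (h.dia_box a), h1, h.join_comm,
    h.join_eq_right (h.zero_le _)] at h3
  refine h.le_antisymm hab (h.le_trans (h.le_dia b) ?_)
  rw [← h3]
  exact h.box_le a

theorem identitySK_iff (h : IsBZLattice A) (hs : StrongDeMorgan A) :
    IdentitySK A ↔ ∀ a b : A, dia a = dia b → box a = box b → a = b := by
  constructor
  · intro hk
    have key : ∀ a b : A, dia a = dia b → box a = box b → le a b := by
      intro a b hd hb
      -- Here a = a ∧ ◇a = a ∧ ◇b ≤ □a ∨ b = □b ∨ b = b.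
      have := hk a b
      rwa [← hd, h.le_dia a, hb, h.join_eq_right (h.box_le b)] at this
    exact fun a b hd hb => h.le_antisymm (key a b hd hb) (key b a hd.symm hb.symm)
  · intro hk x y
    -- The inequality is itself an equation, s ∧ t = s, so it suffices to compare ◇ and □ of its two
    -- sides.
    refine hk _ _ ?_ ?_
    · rw [h.dia_meet hs]
      change le (dia (meet x (dia y))) (dia (join (box x) y))
      rw [h.dia_meet hs, h.dia_join hs, h.dia_dia]
      exact h.le_trans (h.meet_le_right _ _) (h.le_join_right _ _)
    · rw [h.box_meet]
      change le (box (meet x (dia y))) (box (join (box x) y))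
      rw [h.box_meet, h.box_join hs, h.box_of_sharp (h.dia_box x), h.box_of_sharp (h.dia_dia y)]
      exact h.le_trans (h.meet_le_left _ _) (h.le_join_left _ _)

theorem IsParaorthomodular.eq_of_meet_kl_meet (h : IsBoundedLattice A)
    (hp : IsParaorthomodular A) {p q : A} (h₁ : meet p (kl (meet p q)) = zero A)
    (h₂ : meet q (kl (meet p q)) = zero A) : p = q := by
  have e₁ := hp (meet p q) p (h.meet_le_left p q) (by rw [h.meet_comm, h₁])
  have e₂ := hp (meet p q) q (h.meet_le_right p q) (by rw [h.meet_comm, h₂])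
  exact e₁.symm.trans e₂

/-- Reduces equality to terms being 0. This serves both to compare congruences through their
0-classes and to supply the equivalence formulas. -/
theorem IsBZLattice.eq_iff_of_sharp (h : IsBZLattice A) (hp : IsParaorthomodular A) {p q : A}
    (hps : dia p = p) :
    p = q ↔ meet p (kl (meet p q)) = zero A ∧ meet q (kl (meet p q)) = zero A := by
  refine ⟨?_, fun H => hp.eq_of_meet_kl_meet h.toIsBoundedLattice H.1 H.2⟩
  rintro rfl
  rw [h.meet_self, h.meet_comm, h.meet_kl_of_sharp hps]
  exact ⟨rfl, rfl⟩

end Order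

end PBZ

/-! ### Finitarity, uniqueness of the variety semantics, and a criterion for algebraisability -/

namespace UAlg

variable {L : FirstOrder.Language.{0, 0}}

theorem Eqn.HoldsAt.quotient {A : Type u} {s : Setoid A} [ps : L.Prestructure s] {e : Eqn L}
    (he : ∀ v : ℕ → A, @Eqn.HoldsAt L A ps.toStructure e v) (v : ℕ → Quotient s) :
    e.HoldsAt v := by
  obtain ⟨x, rfl⟩ : ∃ x : ℕ → A, v = fun i => (⟦x i⟧ : Quotient s) :=
    ⟨fun i => (v i).out, funext fun i => (Quotient.out_eq (v i)).symm⟩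
  exact (Language.Term.realize_quotient_mk' s e.1 x).trans
    ((congrArg _ (he x)).trans (Language.Term.realize_quotient_mk' s e.2 x).symm)

theorem Eqn.holdsAt_ultraproduct {ι : Type} {U : Ultrafilter ι} {A : ι → Type u}
    [∀ i, L.Structure (A i)] {e : Eqn L} (x : ℕ → ∀ i, A i) :
    e.HoldsAt (fun n => (x n : (U : Filter ι).Product A)) ↔
      ∀ᶠ i in (U : Filter ι), e.HoldsAt fun n => x n i := by
  unfold Eqn.HoldsAt
  rw [Language.Ultraproduct.term_realize_cast, Language.Ultraproduct.term_realize_cast]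
  exact Quotient.eq''

theorem Eqn.HoldsAt.ultraproduct {ι : Type} {U : Ultrafilter ι} {A : ι → Type u}
    [∀ i, L.Structure (A i)] {e : Eqn L} (he : ∀ i, ∀ v : ℕ → A i, e.HoldsAt v)
    (v : ℕ → (U : Filter ι).Product A) : e.HoldsAt v := by
  obtain ⟨x, rfl⟩ : ∃ x : ℕ → ∀ i, A i, v = fun n => (x n : (U : Filter ι).Product A) :=
    ⟨fun i => Quotient.out (v i), funext fun i => (Quotient.out_eq (v i)).symm⟩
  exact (Eqn.holdsAt_ultraproduct x).2 (Filter.Eventually.of_forall fun i => he i _)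

/-- The equational consequence relation of a variety is finitary. -/
theorem EqConseq.exists_finite {K : AlgClass.{u} L} (hK : IsVariety K) {Θ : Set (Eqn L)}
    {e : Eqn L} (h : EqConseq K Θ e) :
    ∃ Θ₀ : Set (Eqn L), Θ₀ ⊆ Θ ∧ Θ₀.Finite ∧ EqConseq K Θ₀ e := by
  obtain ⟨E, rfl⟩ := hK
  by_contra! hc
  -- If no finite part of Θ suffices, each finite S ⊆ Θ has a countermodel. Their ultraproduct
  -- refutes the consequence from Θ itself.
  have hex : ∀ S : Finset Θ, ∃ (A : Bundled.{u} L.Structure) (v : ℕ → A),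
      A ∈ equationalClass E ∧ (∀ d ∈ S, Eqn.HoldsAt d.1 v) ∧ ¬ e.HoldsAt v := by
    intro S
    have := hc (Subtype.val '' (S : Set Θ)) (by rintro _ ⟨d, -, rfl⟩; exact d.2)
      (S.finite_toSet.image _)
    unfold EqConseq at this
    push Not at this
    obtain ⟨A, hA, v, hv, hne⟩ := this
    exact ⟨A, v, hA, fun d hd => hv d ⟨d, hd, rfl⟩, hne⟩
  choose A v hA hv hne using hex
  -- Refining `atTop` makes every cone {S : d ∈ S} large, so each d ∈ Θ holds in the ultraproduct.
  let U : Ultrafilter (Finset Θ) := Ultrafilter.of Filter.atTop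
  have hU : (U : Filter (Finset Θ)) ≤ Filter.atTop := Ultrafilter.of_le _
  let w : ℕ → ∀ S, A S := fun n S => v S n
  have := h ⟨(U : Filter (Finset Θ)).Product fun S => A S, inferInstance⟩
    (fun d hd => Eqn.HoldsAt.ultraproduct fun S => hA S d hd)
    (fun n => (w n : (U : Filter (Finset Θ)).Product fun S => A S)) fun d hd => by
      refine (Eqn.holdsAt_ultraproduct w).2 (hU ?_)
      refine Filter.mem_of_superset (Filter.mem_atTop {⟨d, hd⟩}) fun S hS => ?_
      exact hv S ⟨d, hd⟩ (hS (Finset.mem_singleton_self _))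
  obtain ⟨S, hS⟩ := ((Eqn.holdsAt_ultraproduct w).1 this).exists
  exact hne S hS

theorem assertionalLogic_iff {K : AlgClass.{u} L} {c : L.Constants} {Γ : Set (Fm L)} {φ : Fm L} :
    assertionalLogic K c Γ φ ↔ ∀ A ∈ K, ∀ v : ℕ → A,
      (∀ γ ∈ Γ, γ.realize v = (c : A)) → φ.realize v = (c : A) := by
  simp only [assertionalLogic, EqConseq, Eqn.HoldsAt, Set.forall_mem_image,
    Language.Term.realize_constants]

theorem isDeductiveSystem_assertionalLogic {K : AlgClass.{u} L} (hK : IsVariety K)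
    (c : L.Constants) : IsDeductiveSystem (assertionalLogic K c) where
  refl Γ φ hφ := assertionalLogic_iff.2 fun A _ v hv => hv φ hφ
  cut Γ Γ' φ h₁ h₂ := assertionalLogic_iff.2 fun A hA v hv =>
    assertionalLogic_iff.1 h₂ A hA v fun ψ hψ => assertionalLogic_iff.1 (h₁ ψ hψ) A hA v hv
  structural Γ φ σ h := assertionalLogic_iff.2 fun A hA v hv => by
    rw [Language.Term.realize_subst]
    refine assertionalLogic_iff.1 h A hA _ fun γ hγ => ?_
    rw [← Language.Term.realize_subst]
    exact hv _ ⟨γ, hγ, rfl⟩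
  finitary Γ φ h := by
    obtain ⟨Θ, hΘ, hfin, hc⟩ := EqConseq.exists_finite hK h
    obtain ⟨Γ₀, hs, hf, rfl⟩ := Set.exists_subset_image_finite_and.1 ⟨Θ, hΘ, hfin, rfl⟩
    exact ⟨Γ₀, hs, hf, hc⟩

theorem realize_subst_vec_one {A : Type u} [L.Structure A] (t : L.Term (Fin 1)) (φ : Fm L)
    (v : ℕ → A) : (t.subst ![φ]).realize v = t.realize ![φ.realize v] := by
  rw [Language.Term.realize_subst]
  congr 1
  funext i
  fin_cases i
  rfl

theorem realize_subst_vec_two {A : Type u} [L.Structure A] (t : L.Term (Fin 2)) (φ ψ : Fm L)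
    (v : ℕ → A) : (t.subst ![φ, ψ]).realize v = t.realize ![φ.realize v, ψ.realize v] := by
  rw [Language.Term.realize_subst]
  congr 1
  funext i
  fin_cases i <;> rfl

/-- The truth of τ(φ) under an assignment depends only on the value of φ. -/
theorem holdsAt_of_mem_tauOf_of_eq {τ : Set (L.Term (Fin 1) × L.Term (Fin 1))} {A : Type u}
    [L.Structure A] {v : ℕ → A} {φ ψ : Fm L} (h : φ.realize v = ψ.realize v)
    (hφ : ∀ e ∈ tauOf τ φ, e.HoldsAt v) : ∀ e ∈ tauOf τ ψ, e.HoldsAt v := by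
  rintro _ ⟨e, he, rfl⟩
  have := hφ _ ⟨e, he, rfl⟩
  simp only [Eqn.HoldsAt, realize_subst_vec_one] at this ⊢
  rwa [← h]

/-- The equivalence formulas of one equivalent algebraic semantics entail those of another. -/
theorem IsAlgebraisedBy.delta_entails {R : Consequence L} {K K' : AlgClass.{u} L}
    {τ τ' : Set (L.Term (Fin 1) × L.Term (Fin 1))} {Δ Δ' : Set (L.Term (Fin 2))}
    (h : IsAlgebraisedBy R K τ Δ) (h' : IsAlgebraisedBy R K' τ' Δ') (e : Eqn L) :
    ∀ ψ ∈ deltaOf Δ' e, R (deltaOf Δ e) ψ := by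
  rintro _ ⟨d, hd, rfl⟩
  rw [h.logic_iff]
  intro t ht A hA v hv
  have he : e.HoldsAt v := (h.eqn_equiv e).2 A hA v hv
  -- The formula d(s, s) is a theorem because s ≈ s is valid in K'. Where e = (s, t) holds, d(s, t)
  -- takes the same value as d(s, s), so its defining equations hold too.
  have hrefl : R ∅ (d.subst ![e.1, e.1]) := by
    have := (h'.eqn_iff ∅ (e.1, e.1)).1 (fun _ _ _ _ => rfl) _ ⟨d, hd, rfl⟩
    simpa only [Set.biUnion_empty] using this
  refine holdsAt_of_mem_tauOf_of_eq (φ := d.subst ![e.1, e.1]) ?_ (fun s hs => ?_) t ht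
  · rw [realize_subst_vec_two, realize_subst_vec_two]
    exact congrArg (fun a => d.realize ![e.1.realize v, a]) he
  · exact (h.logic_iff _ _).1 hrefl s hs A hA v (by simp)

/-- Validity of e in K means that Δ(e) consists of theorems; these entail Δ'(e), which expresses
validity of e in K'. -/
theorem IsAlgebraisedBy.eqConseq_empty {R : Consequence L} (hR : IsDeductiveSystem R)
    {K K' : AlgClass.{u} L}
    {τ τ' : Set (L.Term (Fin 1) × L.Term (Fin 1))} {Δ Δ' : Set (L.Term (Fin 2))}
    (h : IsAlgebraisedBy R K τ Δ) (h' : IsAlgebraisedBy R K' τ' Δ') {e : Eqn L}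
    (he : EqConseq K ∅ e) : EqConseq K' ∅ e := by
  rw [h'.eqn_iff]
  rw [h.eqn_iff] at he
  intro ψ hψ
  simp only [Set.biUnion_empty] at he ⊢
  exact hR.cut _ _ _ he (h.delta_entails h' e ψ hψ)

theorem IsVariety.eq_of_eqConseq_iff {K K' : AlgClass.{u} L} (hK : IsVariety K)
    (hK' : IsVariety K') (h : ∀ e, EqConseq K ∅ e ↔ EqConseq K' ∅ e) : K = K' := by
  have key : ∀ {K K' : AlgClass.{u} L}, IsVariety K' →
      (∀ e, EqConseq K' ∅ e → EqConseq K ∅ e) → K ⊆ K' := by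
    rintro K _ ⟨E, rfl⟩ h A hA e he v
    exact h e (fun B hB w _ => hB e he w) A hA v (by simp)
  exact Set.Subset.antisymm (key hK' fun e => (h e).2) (key hK fun e => (h e).1)

/-- A deductive system has at most one equivalent variety semantics. -/
theorem IsEquivalentVarietySemantics.unique {R : Consequence L} (hR : IsDeductiveSystem R)
    {K K' : AlgClass.{u} L} (h : IsEquivalentVarietySemantics R K)
    (h' : IsEquivalentVarietySemantics R K') : K = K' := by
  obtain ⟨hv, τ, Δ, -, -, ha⟩ := h
  obtain ⟨hv', τ', Δ', -, -, ha'⟩ := h'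
  exact hv.eq_of_eqConseq_iff hv' fun e =>
    ⟨ha.eqConseq_empty hR ha', ha'.eqConseq_empty hR ha⟩

/-- If the congruences with `c`-class `{c}` on an algebra lie below one of their number, then the
algebra is reduced exactly when that one is the identity. -/
theorem isReduced_iff_of_isGreatest {A : Type u} [L.Structure A] {c : L.Constants} {θ : Setoid A}
    (hθ : IsGreatest {ψ : Setoid A | IsCongruence (L := L) ψ ∧ constClass c ψ = {(c : A)}} θ) :
    IsReduced c A ↔ θ = ⊥ := by
  have : epsilon (L := L) c ({(c : A)} : Set A) = θ :=
    le_antisymm (sInf_le ⟨hθ.1.1, fun ψ h₁ h₂ => hθ.2 ⟨h₁, h₂⟩⟩)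
      (le_sInf fun ψ hψ => hψ.2 θ hθ.1.1 hθ.1.2)
  rw [IsReduced, this]

/-- Suppose that `K` is a subclass of `V` with the same `c`-assertional logic, and that equality in
the members of `K` is expressed by the equations `d ≈ c` with `d ∈ Δ`. Then `K` is an equivalent
algebraic semantics of this logic. -/
theorem isEquivalentAlgebraicSemantics_assertionalLogic {V K : AlgClass.{u} L} {c : L.Constants}
    {Δ : Set (L.Term (Fin 2))} (hlogic : assertionalLogic V c = assertionalLogic K c)
    (hfin : Δ.Finite)
    (hΔ : ∀ A ∈ K, ∀ a b : A, a = b ↔ ∀ d ∈ Δ, d.realize ![a, b] = (c : A)) :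
    IsEquivalentAlgebraicSemantics (assertionalLogic V c) K := by
  rw [hlogic]
  -- The single defining equation is x ≈ c.
  have htau : ∀ φ : Fm L,
      tauOf {((Language.var 0 : L.Term (Fin 1)), c.term)} φ = {(φ, c.term)} := by
    intro φ
    rw [tauOf, Set.image_singleton]
    congr 2
    simp only [Language.Constants.term, Language.Term.subst]
    congr 1
    funext i
    exact i.elim0
  have hdelta : ∀ A ∈ K, ∀ (v : ℕ → A) (e : Eqn L),
      (∀ ψ ∈ deltaOf Δ e, ψ.realize v = (c : A)) ↔ e.HoldsAt v := by
    intro A hA v e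
    rw [Eqn.HoldsAt, hΔ A hA, deltaOf, Set.forall_mem_image]
    simp only [realize_subst_vec_two]
  have hhold : ∀ (A : Bundled.{u} L.Structure) (v : ℕ → A) (φ : Fm L),
      Eqn.HoldsAt (φ, c.term) v ↔ φ.realize v = (c : A) := by
    intro A v φ
    rw [Eqn.HoldsAt, Language.Term.realize_constants]
  have hunion : ∀ (A : Bundled.{u} L.Structure) (v : ℕ → A) (Γ : Set (Fm L)),
      (∀ d ∈ ⋃ γ ∈ Γ, tauOf {((Language.var 0 : L.Term (Fin 1)), c.term)} γ, d.HoldsAt v) ↔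
        ∀ γ ∈ Γ, γ.realize v = (c : A) := by
    intro A v Γ
    constructor
    · intro h γ hγ
      exact (hhold A v γ).1 (h _ (Set.mem_biUnion hγ (by rw [htau]; rfl)))
    · intro h d hd
      obtain ⟨γ, hγ, hd⟩ := Set.mem_iUnion₂.1 hd
      rw [htau] at hd
      obtain rfl := hd
      exact (hhold A v γ).2 (h γ hγ)
  have hunion' : ∀ A ∈ K, ∀ (v : ℕ → A) (Θ : Set (Eqn L)),
      (∀ γ ∈ ⋃ d ∈ Θ, deltaOf Δ d, γ.realize v = (c : A)) ↔ ∀ d ∈ Θ, d.HoldsAt v := by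
    intro A hA v Θ
    simp only [← hdelta A hA, Set.mem_iUnion]
    grind
  refine ⟨{(Language.var 0, c.term)}, Δ, Set.finite_singleton _, hfin, ?_, ?_, ?_, ?_⟩
  · intro Γ φ
    simp only [assertionalLogic_iff, EqConseq, hunion]
    simp only [htau, Set.mem_singleton_iff, forall_eq, hhold]
  · intro Θ e
    simp only [assertionalLogic_iff]
    constructor
    · intro h ψ hψ A hA v hv
      exact (hdelta A hA v e).2 (h A hA v ((hunion' A hA v Θ).1 hv)) ψ hψ
    · intro h A hA v hv
      exact (hdelta A hA v e).1 fun ψ hψ => h ψ hψ A hA v ((hunion' A hA v Θ).2 hv)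
  · intro φ
    simp only [htau, assertionalLogic_iff]
    constructor
    · intro ψ hψ A hA v hv
      refine (hunion' A hA v _).2 ?_ ψ hψ
      rintro _ rfl
      exact (hhold A v φ).2 (hv φ rfl)
    · intro A hA v hv
      exact (hhold A v φ).1 ((hunion' A hA v _).1 hv _ rfl)
  · intro e
    constructor
    · intro d hd A hA v hv
      refine (hunion A v _).2 ((hdelta A hA v e).2 (hv e rfl)) d hd
    · intro A hA v hv
      exact (hdelta A hA v e).1 ((hunion A v _).1 hv)

end UAlg

/-! ### Identities for `SDM` and `SK` -/

namespace PBZ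

section Terms

variable {α : Type}

def tMeet (s t : lang.Term α) : lang.Term α :=
  Language.Term.func (L := lang) (l := 2) Op.meet ![s, t]

def tJoin (s t : lang.Term α) : lang.Term α :=
  Language.Term.func (L := lang) (l := 2) Op.join ![s, t]

def tKl (s : lang.Term α) : lang.Term α := Language.Term.func (L := lang) (l := 1) Op.kleene ![s]

def tBr (s : lang.Term α) : lang.Term α := Language.Term.func (L := lang) (l := 1) Op.brouwer ![s]

variable (α) in
def tZero : lang.Term α := Language.Term.func (L := lang) (l := 0) Op.zero ![]

variable (α) in
def tOne : lang.Term α := Language.Term.func (L := lang) (l := 0) Op.one ![]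

variable {A : Type u} [lang.Structure A] (v : α → A) (s t : lang.Term α)

theorem funMap_meet (x : Fin 2 → A) :
    Language.Structure.funMap (L := lang) Op.meet x = meet (x 0) (x 1) := by
  rw [meet]; congr 1; funext i; fin_cases i <;> rfl

theorem funMap_join (x : Fin 2 → A) :
    Language.Structure.funMap (L := lang) Op.join x = join (x 0) (x 1) := by
  rw [join]; congr 1; funext i; fin_cases i <;> rfl

theorem funMap_kleene (x : Fin 1 → A) :
    Language.Structure.funMap (L := lang) Op.kleene x = kl (x 0) := by
  rw [kl]; congr 1; funext i; fin_cases i; rfl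

theorem funMap_brouwer (x : Fin 1 → A) :
    Language.Structure.funMap (L := lang) Op.brouwer x = br (x 0) := by
  rw [br]; congr 1; funext i; fin_cases i; rfl

theorem funMap_zero (x : Fin 0 → A) :
    Language.Structure.funMap (L := lang) Op.zero x = zero A := by
  rw [zero]; congr 1; funext i; exact i.elim0

theorem funMap_one (x : Fin 0 → A) :
    Language.Structure.funMap (L := lang) Op.one x = one A := by
  rw [one]; congr 1; funext i; exact i.elim0

theorem coe_zeroSymb : ((zeroSymb : lang.Constants) : A) = zero A := funMap_zero _

@[simp]
theorem realize_tMeet : (tMeet s t).realize v = meet (s.realize v) (t.realize v) := funMap_meet _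

@[simp]
theorem realize_tJoin : (tJoin s t).realize v = join (s.realize v) (t.realize v) := funMap_join _

@[simp]
theorem realize_tKl : (tKl s).realize v = kl (s.realize v) := funMap_kleene _

@[simp]
theorem realize_tBr : (tBr s).realize v = br (s.realize v) := funMap_brouwer _

@[simp]
theorem realize_tZero : (tZero α).realize v = zero A := funMap_zero _

@[simp]
theorem realize_tOne : (tOne α).realize v = one A := funMap_one _

end Terms

/-- The inequality `s ≤ t` as an identity. -/
def tLe (s t : lang.Term ℕ) : UAlg.Eqn lang := (tMeet s t, s)

/-- The conditional identities `x ≤ y ⟹ y' ≤ x'` and `x ≤ y ⟹ y^∼ ≤ x^∼` are stated for `x ∧ y`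
and `y`; paraorthomodularity is replaced by the orthomodular law for the elements `◇x`. -/
def sdmAxioms : List (UAlg.Eqn lang) :=
  let x : lang.Term ℕ := Language.var 0
  let y : lang.Term ℕ := Language.var 1
  let z : lang.Term ℕ := Language.var 2
  let p := tMeet (tBr (tBr x)) (tBr (tBr y))
  [(tMeet x y, tMeet y x), (tJoin x y, tJoin y x),
    (tMeet (tMeet x y) z, tMeet x (tMeet y z)), (tJoin (tJoin x y) z, tJoin x (tJoin y z)),
    (tMeet x (tJoin x y), x), (tJoin x (tMeet x y), x), tLe (tZero ℕ) x, tLe x (tOne ℕ),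
    (tKl (tKl x), x), tLe (tKl y) (tKl (tMeet x y)),
    tLe (tMeet x (tKl x)) (tJoin y (tKl y)),
    (tMeet x (tBr x), tZero ℕ), tLe x (tBr (tBr x)), tLe (tBr y) (tBr (tMeet x y)),
    (tKl (tBr x), tBr (tBr x)),
    tLe (tBr (tMeet x (tKl x))) (tJoin (tBr x) (tBr (tKl x))),
    (tBr (tMeet x y), tJoin (tBr x) (tBr y)),
    (tJoin p (tMeet (tKl p) (tBr (tBr y))), tBr (tBr y))]

theorem sdm_eq_equationalClass : SDM.{u} = UAlg.equationalClass {e | e ∈ sdmAxioms} := by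
  ext A
  simp only [UAlg.equationalClass, Set.mem_ofPred_eq, sdmAxioms, List.forall_mem_cons, tLe,
    UAlg.Eqn.HoldsAt, realize_tMeet, realize_tJoin, realize_tKl, realize_tBr, realize_tZero,
    realize_tOne, Language.Term.realize_var]
  constructor
  · rintro ⟨h, hs⟩
    exact ⟨fun v => h.meet_comm _ _, fun v => h.join_comm _ _, fun v => h.meet_assoc _ _ _,
      fun v => h.join_assoc _ _ _, fun v => h.meet_join _ _, fun v => h.join_meet _ _,
      fun v => h.zero_le _, fun v => h.le_one _, fun v => h.kl_kl _,
      fun v => h.kl_anti _ _ (h.meet_le_right _ _), fun v => h.kleene _ _, fun v => h.meet_br _,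
      fun v => h.le_br_br _, fun v => h.br_anti _ _ (h.meet_le_right _ _), fun v => h.kl_br _,
      fun v => h.star _, fun v => hs _ _,
      fun v => h.diamondOrthomodular_of_paraorthomodular hs h.para _ _, by simp⟩
  · rintro ⟨h1, h2, h3, h4, h5, h6, h7, h8, h9, h10, h11, h12, h13, h14, h15, h16, h17, h18, -⟩
    have val : ∀ a b c : A, ∃ v : ℕ → A, v 0 = a ∧ v 1 = b ∧ v 2 = c := fun a b c =>
      ⟨fun n => if n = 0 then a else if n = 1 then b else c, by simp⟩
    have hBZ : IsBZStarLattice A :=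
      { meet_comm := fun a b => by obtain ⟨v, rfl, rfl, -⟩ := val a b b; exact h1 v
        join_comm := fun a b => by obtain ⟨v, rfl, rfl, -⟩ := val a b b; exact h2 v
        meet_assoc := fun a b c => by obtain ⟨v, rfl, rfl, rfl⟩ := val a b c; exact h3 v
        join_assoc := fun a b c => by obtain ⟨v, rfl, rfl, rfl⟩ := val a b c; exact h4 v
        meet_join := fun a b => by obtain ⟨v, rfl, rfl, -⟩ := val a b b; exact h5 v
        join_meet := fun a b => by obtain ⟨v, rfl, rfl, -⟩ := val a b b; exact h6 v
        zero_le := fun a => by obtain ⟨v, rfl, -⟩ := val a a a; exact h7 v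
        le_one := fun a => by obtain ⟨v, rfl, -⟩ := val a a a; exact h8 v
        kl_kl := fun a => by obtain ⟨v, rfl, -⟩ := val a a a; exact h9 v
        kl_anti := fun a b hab => by
          obtain ⟨v, rfl, rfl, -⟩ := val a b b
          have := h10 v
          rwa [hab] at this
        kleene := fun a b => by obtain ⟨v, rfl, rfl, -⟩ := val a b b; exact h11 v
        meet_br := fun a => by obtain ⟨v, rfl, -⟩ := val a a a; exact h12 v
        le_br_br := fun a => by obtain ⟨v, rfl, -⟩ := val a a a; exact h13 v
        br_anti := fun a b hab => by
          obtain ⟨v, rfl, rfl, -⟩ := val a b b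
          have := h14 v
          rwa [hab] at this
        kl_br := fun a => by obtain ⟨v, rfl, -⟩ := val a a a; exact h15 v
        star := fun a => by obtain ⟨v, rfl, -⟩ := val a a a; exact h16 v }
    have hs : StrongDeMorgan A := fun a b => by
      obtain ⟨v, rfl, rfl, -⟩ := val a b b; exact h17 v
    refine ⟨⟨hBZ, hBZ.paraorthomodular_of_diamondOrthomodular hs fun a b => ?_⟩, hs⟩
    obtain ⟨v, rfl, rfl, -⟩ := val a b b
    exact h18 v

theorem isVariety_sdm : UAlg.IsVariety SDM.{u} := ⟨_, sdm_eq_equationalClass⟩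

theorem isVariety_sk : UAlg.IsVariety SK.{u} := by
  let x : lang.Term ℕ := Language.var 0
  let y : lang.Term ℕ := Language.var 1
  let e : UAlg.Eqn lang := tLe (tMeet x (tBr (tBr y))) (tJoin (tBr (tKl x)) y)
  have he : ∀ {A : Type u} [lang.Structure A] (v : ℕ → A), e.HoldsAt v ↔
      le (meet (v 0) (dia (v 1))) (join (box (v 0)) (v 1)) := by
    intro A _ v
    simp only [UAlg.Eqn.HoldsAt, e, tLe, realize_tMeet, realize_tJoin, realize_tKl, realize_tBr,
      x, y, Language.Term.realize_var]
    rfl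
  refine ⟨insert e {e | e ∈ sdmAxioms}, ?_⟩
  ext A
  have hA : A ∈ SDM ↔ A ∈ UAlg.equationalClass {e | e ∈ sdmAxioms} := by
    rw [sdm_eq_equationalClass]
  change A ∈ SDM ∧ IdentitySK A ↔ _
  rw [hA]
  simp only [UAlg.equationalClass, Set.mem_ofPred_eq, Set.forall_mem_insert, he]
  constructor
  · exact fun h => ⟨fun v => h.2 _ _, h.1⟩
  · refine fun h => ⟨h.2, fun a b => ?_⟩
    simpa using h.1 fun n => if n = 0 then a else b

/-- The relation of having the same `◇` and the same `□`. -/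
def modalSetoid (A : Type u) [lang.Structure A] : Setoid A :=
  Setoid.ker fun a : A => (dia a, box a)

theorem modalSetoid_iff {A : Type u} [lang.Structure A] {a b : A} :
    modalSetoid A a b ↔ dia a = dia b ∧ box a = box b :=
  Prod.mk_inj

/-! ### The greatest congruence with 0-class {0} -/

section Congruence

variable {A : Type u} [lang.Structure A]

/-- Meets and joins are preserved by ◇ and □. For the complements, ◇(a') = (□a)^∼, □(a') = (◇a)^∼
and a^∼ = (◇a)^∼, so the results depend only on ◇a and □a. -/
theorem isCongruence_modalSetoid (h : IsBZLattice A) (hs : StrongDeMorgan A) :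
    UAlg.IsCongruence (L := lang) (modalSetoid A) := by
  intro n f x y hxy
  replace hxy := fun i => modalSetoid_iff.1 (hxy i)
  rw [modalSetoid_iff]
  change Op n at f
  cases f with
  | meet =>
    simp only [funMap_meet, h.dia_meet hs, h.box_meet, hxy, and_self]
  | join =>
    simp only [funMap_join, h.dia_join hs, h.box_join hs, hxy, and_self]
  | kleene =>
    have : ∀ a : A, dia (kl a) = br (box a) := fun a => rfl
    simp only [funMap_kleene, this, h.box_kl, hxy, and_self]
  | brouwer =>
    have : ∀ a : A, br a = br (dia a) := fun a => (h.br_br_br a).symm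
    rw [funMap_brouwer, funMap_brouwer, this (x 0), this (y 0), (hxy 0).1]
    exact ⟨rfl, rfl⟩
  | zero => simp only [funMap_zero, and_self]
  | one => simp only [funMap_one, and_self]

theorem IsCongruence.meet {θ : Setoid A} (hθ : UAlg.IsCongruence (L := lang) θ) {a b c d : A}
    (h₁ : θ a b) (h₂ : θ c d) : θ (meet a c) (meet b d) :=
  hθ 2 Op.meet ![a, c] ![b, d] (by intro i; fin_cases i <;> assumption)

theorem IsCongruence.kl {θ : Setoid A} (hθ : UAlg.IsCongruence (L := lang) θ) {a b : A}
    (h₁ : θ a b) : θ (kl a) (kl b) :=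
  hθ 1 Op.kleene ![a] ![b] (by intro i; fin_cases i; assumption)

theorem IsCongruence.br {θ : Setoid A} (hθ : UAlg.IsCongruence (L := lang) θ) {a b : A}
    (h₁ : θ a b) : θ (br a) (br b) :=
  hθ 1 Op.brouwer ![a] ![b] (by intro i; fin_cases i; assumption)

/-- The relation `modalSetoid` is the greatest congruence whose `0`-class is `{0}`. -/
theorem isGreatest_modalSetoid (h : IsPBZStarLattice A) (hs : StrongDeMorgan A) :
    IsGreatest {ψ : Setoid A | UAlg.IsCongruence (L := lang) ψ ∧
      UAlg.constClass zeroSymb ψ = {((zeroSymb : lang.Constants) : A)}} (modalSetoid A) := by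
  refine ⟨⟨isCongruence_modalSetoid h.toIsBZLattice hs, ?_⟩, ?_⟩
  · ext a
    simp only [UAlg.constClass, Set.mem_ofPred_eq, Set.mem_singleton_iff, modalSetoid_iff,
      coe_zeroSymb, h.dia_zero, h.box_zero]
    constructor
    · intro ha
      refine h.eq_zero_of_le ?_
      rw [← ha.1]
      exact h.le_dia a
    · rintro rfl
      exact ⟨h.dia_zero, h.box_zero⟩
  · rintro ψ ⟨hψ, h0⟩ a b hab
    have zero_of : ∀ {c : A}, ψ c (zero A) → c = zero A := by
      intro c hc
      rw [← coe_zeroSymb] at hc ⊢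
      exact (Set.ext_iff.1 h0 c).1 hc
    -- On sharp elements ψ is equality: replacing q by p turns p ∧ (p ∧ q)' into p ∧ p' = 0, and the
    -- 0-class of ψ is {0}.
    have key : ∀ {p q : A}, dia p = p → dia q = q → ψ p q → p = q := by
      intro p q hp hq hpq
      rw [h.eq_iff_of_sharp h.para hp]
      refine ⟨zero_of ?_, zero_of ?_⟩
      · have := IsCongruence.meet hψ (ψ.refl p)
          (IsCongruence.kl hψ (IsCongruence.meet hψ (ψ.refl p) (ψ.symm hpq)))
        rwa [h.meet_self, h.meet_comm p (kl p), h.meet_kl_of_sharp hp] at this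
      · have := IsCongruence.meet hψ (ψ.refl q)
          (IsCongruence.kl hψ (IsCongruence.meet hψ hpq (ψ.refl q)))
        rwa [h.meet_self, h.meet_comm q (kl q), h.meet_kl_of_sharp hq] at this
    rw [modalSetoid_iff]
    exact ⟨key (h.dia_dia a) (h.dia_dia b) (IsCongruence.br hψ (IsCongruence.br hψ hab)),
      key (h.dia_box a) (h.dia_box b) (IsCongruence.br hψ (IsCongruence.kl hψ hab))⟩

theorem identitySK_iff_modalSetoid_eq_bot (h : IsBZLattice A) (hs : StrongDeMorgan A) :
    IdentitySK A ↔ modalSetoid A = ⊥ := by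
  rw [identitySK_iff h hs, eq_bot_iff, Setoid.le_def]
  simp only [modalSetoid_iff, Setoid.bot_def, and_imp]

end Congruence

/-! ### Reduced algebras, the quotient in `SK`, and the equivalence formulas -/

theorem reducedAlgebras_sdm : UAlg.reducedAlgebras SDM.{u} zeroSymb = SK.{u} := by
  ext A
  refine and_congr_right fun hA => ?_
  rw [UAlg.isReduced_iff_of_isGreatest (isGreatest_modalSetoid hA.1 hA.2),
    identitySK_iff_modalSetoid_eq_bot hA.1.toIsBZLattice hA.2]

/-- The structure on the quotient of an algebra in `SDM` by `modalSetoid`. -/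
@[reducible]
def modalPrestructure {A : Type u} [i : lang.Structure A] (h : IsBZLattice A)
    (hs : StrongDeMorgan A) : lang.Prestructure (modalSetoid A) where
  toStructure := i
  fun_equiv x y hxy := isCongruence_modalSetoid h hs _ _ x y hxy
  rel_equiv {_} {r} := nomatch r

theorem exists_sk_quotient {A : Bundled.{u} lang.Structure} (hA : A ∈ SDM) :
    ∃ B ∈ SK.{u}, ∃ π : A → B,
      (∀ (t : UAlg.Fm lang) (v : ℕ → A), t.realize (fun n => π (v n)) = π (t.realize v)) ∧
      ∀ a : A, π a = ((zeroSymb : lang.Constants) : B) ↔ a = ((zeroSymb : lang.Constants) : A) := by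
  let _ := modalPrestructure hA.1.toIsBZLattice hA.2
  let B : Bundled.{u} lang.Structure := ⟨Quotient (modalSetoid A), inferInstance⟩
  let π : A → B := fun a => (⟦a⟧ : Quotient (modalSetoid A))
  have hπ : ∀ (t : UAlg.Fm lang) (v : ℕ → A),
      t.realize (fun n => π (v n)) = π (t.realize v) :=
    fun t v => Language.Term.realize_quotient_mk' (modalSetoid A) t v
  -- Paraorthomodularity is a quasi-identity, so its passage to the quotient relies on the
  -- axiomatisation of `SDM` by identities.
  have hB : B ∈ SDM := by
    have hA' := hA
    rw [sdm_eq_equationalClass] at hA' ⊢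
    exact fun e he => UAlg.Eqn.HoldsAt.quotient fun v => hA' e he v
  have hbr : ∀ a : A, br (π a) = π (br a) := fun a => by
    simpa using hπ (tBr (Language.var 0)) fun _ => a
  have hkl : ∀ a : A, kl (π a) = π (kl a) := fun a => by
    simpa using hπ (tKl (Language.var 0)) fun _ => a
  have hzero : π ((zeroSymb : lang.Constants) : A) = ((zeroSymb : lang.Constants) : B) := by
    simpa using (hπ zeroSymb.term fun _ => ((zeroSymb : lang.Constants) : A)).symm
  have hker : ∀ a b : A, π a = π b ↔ dia a = dia b ∧ box a = box b := fun a b =>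
    Quotient.eq.trans modalSetoid_iff
  refine ⟨B, ⟨hB, (identitySK_iff hB.1.toIsBZLattice hB.2).2 fun p q => ?_⟩, π, hπ, fun a => ?_⟩
  -- The quotient is again separated by ◇ and □: since ◇◇a = ◇a and ◇□a = □a, equality of the
  -- classes of ◇a and ◇b, and of □a and □b, already gives equality in A.
  · obtain ⟨a, rfl⟩ : ∃ a, π a = p := Quotient.exists_rep p
    obtain ⟨b, rfl⟩ : ∃ b, π b = q := Quotient.exists_rep q
    simp only [dia, box, hbr, hkl]
    intro h₁ h₂
    refine (hker a b).2 ⟨?_, ?_⟩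
    · have := ((hker _ _).1 h₁).1
      rwa [← dia, ← dia, hA.1.dia_dia, hA.1.dia_dia] at this
    · have := ((hker _ _).1 h₂).1
      rwa [← box, ← box, hA.1.dia_box, hA.1.dia_box] at this
  · rw [← hzero]
    exact Quotient.eq.trans
      (Set.ext_iff.1 (isGreatest_modalSetoid hA.1 hA.2).1.2 a)

/-- A countermodel in `SDM` descends to its quotient in `SK`: the premises stay at 0, and a nonzero
conclusion stays nonzero because the quotient map reflects 0. -/
theorem assertionalLogic_sdm_eq :
    UAlg.assertionalLogic SDM.{u} zeroSymb = UAlg.assertionalLogic SK.{u} zeroSymb := by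
  funext Γ φ
  rw [UAlg.assertionalLogic_iff, UAlg.assertionalLogic_iff]
  refine propext ⟨fun h A hA => h A hA.1, fun h A hA v hv => ?_⟩
  obtain ⟨B, hB, π, hπ, h0⟩ := exists_sk_quotient hA
  rw [← h0, ← hπ]
  refine h B hB _ fun γ hγ => ?_
  rw [hπ, h0]
  exact hv γ hγ

/-- The terms whose vanishing says that `◇x = ◇y` and `□x = □y`. -/
def skEquivalence : Set (lang.Term (Fin 2)) :=
  let x : lang.Term (Fin 2) := Language.var 0
  let y : lang.Term (Fin 2) := Language.var 1
  let d := tKl (tMeet (tBr (tBr x)) (tBr (tBr y)))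
  let b := tKl (tMeet (tBr (tKl x)) (tBr (tKl y)))
  {tMeet (tBr (tBr x)) d, tMeet (tBr (tBr y)) d, tMeet (tBr (tKl x)) b, tMeet (tBr (tKl y)) b}

/-- In `SK` the pair (◇a, □a) determines a. Both entries are sharp, so each of the two equalities is
expressed by two terms being 0. -/
theorem eq_iff_skEquivalence {A : Bundled.{u} lang.Structure} (hA : A ∈ SK) (a b : A) :
    a = b ↔ ∀ d ∈ skEquivalence, d.realize ![a, b] = ((zeroSymb : lang.Constants) : A) := by
  obtain ⟨⟨h, hs⟩, hk⟩ := hA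
  have h₁ : a = b ↔ dia a = dia b ∧ box a = box b :=
    ⟨fun e => e ▸ ⟨rfl, rfl⟩, fun H => (identitySK_iff h.toIsBZLattice hs).1 hk a b H.1 H.2⟩
  rw [h₁, h.eq_iff_of_sharp h.para (h.dia_dia a), h.eq_iff_of_sharp h.para (h.dia_box a)]
  simp only [skEquivalence, Set.forall_mem_insert, Set.mem_singleton_iff, forall_eq,
    coe_zeroSymb, realize_tMeet, realize_tKl, realize_tBr, Language.Term.realize_var, and_assoc]
  rfl

theorem isEquivalentVarietySemantics_sk :
    UAlg.IsEquivalentVarietySemantics (UAlg.assertionalLogic SDM.{u} zeroSymb) SK.{u} :=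
  ⟨isVariety_sk, UAlg.isEquivalentAlgebraicSemantics_assertionalLogic assertionalLogic_sdm_eq
    (by unfold skEquivalence; exact Set.toFinite _) fun _ hA => eq_iff_skEquivalence hA⟩

end PBZ

theorem mainTheorem5 :
    UAlg.IsStronglyAlgebraisable.{u} (UAlg.assertionalLogic PBZ.SDM.{u} PBZ.zeroSymb) ∧
    (∀ K : UAlg.AlgClass.{u} PBZ.lang,
      UAlg.IsEquivalentVarietySemantics (UAlg.assertionalLogic PBZ.SDM.{u} PBZ.zeroSymb) K ↔
        K = UAlg.reducedAlgebras PBZ.SDM.{u} PBZ.zeroSymb) ∧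
    UAlg.reducedAlgebras PBZ.SDM.{u} PBZ.zeroSymb = PBZ.SK.{u} := by
  have hR := UAlg.isDeductiveSystem_assertionalLogic PBZ.isVariety_sdm.{u} PBZ.zeroSymb
  have hK := PBZ.isEquivalentVarietySemantics_sk.{u}
  rw [PBZ.reducedAlgebras_sdm]
  refine ⟨⟨hR, PBZ.SK, hK⟩, fun K => ⟨fun h => h.unique hR hK, ?_⟩, rfl⟩
  rintro rfl
  exact hK
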